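/- Let $d\ge 0$ be an integer and let $\gamma_1,\gamma_2:[0,1]\to\mathbb{R}^d$ be curves of class $C^2$ (up to the endpoints, with one-sided derivatives there). For $1<p<\infty$ define $$f_p:[0,1]^2\to\mathbb{R},\qquad f_p(t_1,t_2)=\sum_{i=1}^d\bigl|(\gamma_1)_i(t_1)-(\gamma_2)_i(t_2)\bigr|^p .$$ A point $(t_1,t_2)\in[0,1]^2$ is called a critical (or singular) point of $f_p$ if the derivative of $f_p$ at $(t_1,t_2)$ (one-sided on the boundary of the square) is zero. A critical value is the image under $f_p$ of a critical point, and $\mathcal{R}_p\subset\mathbb{R}$, the set of regular values, is the set of all real numbers that are not critical values. Then: 1. $\mathcal{R}_p$ is open in $\mathbb{R}$ for every $1<p<\infty$. 2. $\mathcal{R}_p$ is dense in $\mathbb{R}$ for every $2\le p<\infty$. 3. For every $1<p<2$ there is an open dense set $U\subset\mathbb{R}$ such that every critical point $(t_1,t_2)$ of $f_p$ with $f_p(t_1,t_2)\in U$ satisfies $(\gamma_1)_i(t_1)=(\gamma_2)_i(t_2)$ for some $1\le i\le d$. 4. If the set of all $(t_1,t_2)\in[0,1]^2$ such that $(\gamma_1)_i'(t_1)=(\gamma_2)_i'(t_2)=0$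 for all $1\le i\le d$ has two-dimensional Lebesgue measure zero, then $\mathcal{R}_p$ is dense in $\mathbb{R}$ for every $1<p<\infty$. -/

import Mathlib

open Set MeasureTheory

/-- The joint parameter space `[0,1]²` of two curves. -/
def unitSquare : Set (ℝ × ℝ) := Icc (0 : ℝ) 1 ×ˢ Icc (0 : ℝ) 1

/-- The function `(t₁, t₂) ↦ ∑ i, |(γ₁)ᵢ(t₁) - (γ₂)ᵢ(t₂)| ^ p`. It is only ever considered on
`unitSquare`. -/
noncomputable def distPow {d : ℕ} (p : ℝ) (γ₁ γ₂ : ℝ → Fin d → ℝ) (t : ℝ × ℝ) : ℝ :=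
  ∑ i, |γ₁ t.1 i - γ₂ t.2 i| ^ p

/-- The critical (singular) points of `distPow p γ₁ γ₂` on `[0,1]²`: the points of the closed
square at which the derivative relative to the square (so one-sided at its boundary) is zero. -/
def criticalPoints {d : ℕ} (p : ℝ) (γ₁ γ₂ : ℝ → Fin d → ℝ) : Set (ℝ × ℝ) :=
  {t | t ∈ unitSquare ∧
    HasFDerivWithinAt (distPow p γ₁ γ₂) (0 : ℝ × ℝ →L[ℝ] ℝ) unitSquare t}

/-- The regular values: the real numbers that are not the image of a critical point. -/
def regularValues {d : ℕ} (p : ℝ) (γ₁ γ₂ : ℝ → Fin d → ℝ) : Set ℝ :=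
  (distPow p γ₁ γ₂ '' criticalPoints p γ₁ γ₂)ᶜ

/-- The parameter pairs at which the derivatives of all the coordinates of both curves vanish
(one-sided derivatives at the ends of `[0,1]`). -/
def commonCriticalParameters {d : ℕ} (γ₁ γ₂ : ℝ → Fin d → ℝ) : Set (ℝ × ℝ) :=
  {t | t ∈ unitSquare ∧ ∀ i,
    derivWithin (fun s => γ₁ s i) (Icc 0 1) t.1 = 0 ∧
    derivWithin (fun s => γ₂ s i) (Icc 0 1) t.2 = 0}

/-!
Split the square according to the set `T` of coordinates in which the two points differ. On the
stratum of `T` the summands with index outside `T` have zero derivative, because `p > 1`; so a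
critical point of the full sum is a critical point of the partial sum over `T`, with the same
value. The partial sum is `C²` there even when `p < 2`, since its summands stay away from zero.
Hence all critical values are critical values of finitely many functions that are `C²` at the points
concerned.

The critical values of a `C²` function `f` on an `n`-dimensional convex set are `μH[n / 2]`-null:
along the critical points near `x`, `f` is `2`-Hölder with any constant above `‖D²f x‖`. Critical
points with `D²f ≠ 0` are not density points of the critical set, so they form a null set, and at
those with `D²f = 0` the Hölder constant is arbitrarily small. For the square, `n / 2 = 1`.
-/

open Filter Topology Metric Measure Module
open scoped NNReal ENNReal

section LocalImage

variable {X Y : Type*} [TopologicalSpace X] [SecondCountableTopology X]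

theorem measure_image_null_of_locally_null [MeasurableSpace Y] {μ : Measure Y} {f : X → Y}
    {s : Set X} (h : ∀ x ∈ s, ∃ t ∈ 𝓝[s] x, μ (f '' t) = 0) : μ (f '' s) = 0 :=
  measure_null_of_locally_null (μ := OuterMeasure.comap f μ.toOuterMeasure) s h

theorem exists_seq_disjoint_measurableSet_cover [MeasurableSpace X] [OpensMeasurableSpace X]
    {s : Set X} {P : Set X → Prop} (hempty : P ∅) (hmono : ∀ ⦃t u⦄, t ⊆ u → P u → P t)
    (hloc : ∀ x ∈ s, ∃ t ∈ 𝓝[s] x, P t) :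
    ∃ D : ℕ → Set X, (∀ n, MeasurableSet (D n)) ∧ Pairwise (Function.onFun Disjoint D) ∧
      s ⊆ ⋃ n, D n ∧ ∀ n, P (D n ∩ s) := by
  have hbasis := TopologicalSpace.isBasis_countableBasis X
  let S : Set (Set X) := insert ∅ {b ∈ TopologicalSpace.countableBasis X | P (b ∩ s)}
  obtain ⟨v, hv⟩ : ∃ v : ℕ → Set X, S = range v :=
    (((TopologicalSpace.countable_countableBasis X).mono (sep_subset _ _)).insert ∅).exists_eq_range
      (insert_nonempty _ _)
  have hvS (n : ℕ) : v n ∈ S := hv ▸ mem_range_self n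
  have hvo (n : ℕ) : IsOpen (v n) := by
    rcases hvS n with hn | hn
    · exact hn ▸ isOpen_empty
    · exact hbasis.isOpen hn.1
  have hvP (n : ℕ) : P (v n ∩ s) := by
    rcases hvS n with hn | hn
    · rwa [hn, empty_inter]
    · exact hn.2
  refine ⟨disjointed v, fun n => .disjointed (fun m => (hvo m).measurableSet) n,
    disjoint_disjointed v, fun x hx => ?_,
    fun n => hmono (inter_subset_inter_left s (disjointed_subset v n)) (hvP n)⟩
  obtain ⟨t, ht, hPt⟩ := hloc x hx
  obtain ⟨b, ⟨hb, hxb⟩, hbt⟩ := (nhdsWithin_hasBasis hbasis.nhds_hasBasis s).mem_iff.1 ht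
  obtain ⟨n, rfl⟩ : b ∈ range v := hv ▸ Or.inr ⟨hb, hmono hbt hPt⟩
  rw [iUnion_disjointed]
  exact mem_iUnion_of_mem n hxb

end LocalImage

section HolderImage

variable {X Y : Type*} [EMetricSpace X] [SecondCountableTopology X] [MeasurableSpace X]
  [BorelSpace X] [EMetricSpace Y] [MeasurableSpace Y] [BorelSpace Y]
  {f : X → Y} {s : Set X} {r : ℝ≥0} {d : ℝ}

theorem hausdorffMeasure_image_le_of_locally_holderOnWith {C : ℝ≥0} (hr : 0 < r) (hd : 0 ≤ d)
    (h : ∀ x ∈ s, ∃ t ∈ 𝓝[s] x, HolderOnWith C r f t) :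
    μH[d] (f '' s) ≤ (C : ℝ≥0∞) ^ d * μH[r * d] s := by
  obtain ⟨D, hDm, hDd, hsD, hD⟩ := exists_seq_disjoint_measurableSet_cover
    (holderOnWith_empty C r f) (fun _ _ htu hu => hu.mono htu) h
  calc μH[d] (f '' s) ≤ μH[d] (⋃ n, f '' (D n ∩ s)) := by
        rw [← image_iUnion, ← iUnion_inter, inter_eq_right.2 hsD]
    _ ≤ ∑' n, μH[d] (f '' (D n ∩ s)) := measure_iUnion_le _
    _ ≤ ∑' n, (C : ℝ≥0∞) ^ d * μH[r * d] (D n ∩ s) :=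
        ENNReal.tsum_le_tsum fun n => (hD n).hausdorffMeasure_image_le hr hd
    _ = (C : ℝ≥0∞) ^ d * (μH[r * d]).restrict s (⋃ n, D n) := by
        rw [ENNReal.tsum_mul_left, measure_iUnion hDd hDm]
        simp_rw [restrict_apply (hDm _)]
    _ ≤ (C : ℝ≥0∞) ^ d * μH[r * d] s := by
        gcongr _ * ?_
        exact (measure_mono (subset_univ _)).trans_eq (restrict_apply_univ s)

theorem hausdorffMeasure_image_null_of_locally_holderOnWith (hr : 0 < r) (hd : 0 ≤ d)
    (hs : μH[r * d] s = 0) (h : ∀ x ∈ s, ∃ C : ℝ≥0, ∃ t ∈ 𝓝[s] x, HolderOnWith C r f t) :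
    μH[d] (f '' s) = 0 := by
  refine measure_image_null_of_locally_null fun x hx => ?_
  obtain ⟨C, t, ht, hC⟩ := h x hx
  refine ⟨t ∩ s, inter_mem ht self_mem_nhdsWithin, nonpos_iff_eq_zero.1 ?_⟩
  calc μH[d] (f '' (t ∩ s)) ≤ (C : ℝ≥0∞) ^ d * μH[r * d] (t ∩ s) :=
        (hC.mono inter_subset_left).hausdorffMeasure_image_le hr hd
    _ = 0 := by rw [measure_mono_null inter_subset_right hs, mul_zero]

theorem hausdorffMeasure_image_null_of_locally_holderOnWith_small
    [IsLocallyFiniteMeasure (μH[r * d] : Measure X)] (hr : 0 < r) (hd : 0 < d)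
    (h : ∀ x ∈ s, ∀ ε : ℝ≥0, 0 < ε → ∃ t ∈ 𝓝[s] x, HolderOnWith ε r f t) :
    μH[d] (f '' s) = 0 := by
  refine measure_image_null_of_locally_null fun x _ => ?_
  obtain ⟨t, ht, htfin⟩ := (μH[r * d] : Measure X).finiteAt_nhdsWithin x s
  refine ⟨t ∩ s, inter_mem ht self_mem_nhdsWithin, nonpos_iff_eq_zero.1 ?_⟩
  have hle (ε : ℝ≥0) (hε : 0 < ε) :
      μH[d] (f '' (t ∩ s)) ≤ (ε : ℝ≥0∞) ^ d * μH[r * d] (t ∩ s) := by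
    refine hausdorffMeasure_image_le_of_locally_holderOnWith hr hd.le fun y hy => ?_
    obtain ⟨u, hu, hεu⟩ := h y hy.2 ε hε
    exact ⟨u, nhdsWithin_mono y inter_subset_right hu, hεu⟩
  have hlim : Tendsto (fun ε : ℝ≥0 => (ε : ℝ≥0∞) ^ d * μH[r * d] (t ∩ s)) (𝓝[>] 0) (𝓝 0) := by
    have hpow : Tendsto (fun ε : ℝ≥0 => (ε : ℝ≥0∞) ^ d) (𝓝 0) (𝓝 0) := by
      simpa [hd, Function.comp_def] using
        ((ENNReal.continuous_rpow_const (y := d)).comp ENNReal.continuous_coe).tendsto 0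
    have hfin : μH[r * d] (t ∩ s) ≠ ∞ := ((measure_mono inter_subset_left).trans_lt htfin).ne
    simpa using (ENNReal.Tendsto.mul_const hpow (Or.inr hfin)).mono_left nhdsWithin_le_nhds
  exact ge_of_tendsto hlim (eventually_mem_nhdsWithin.mono hle)

end HolderImage

section DensityPoints

variable {E F : Type*} [NormedAddCommGroup E] [NormedSpace ℝ E] [FiniteDimensional ℝ E]
  [MeasurableSpace E] [BorelSpace E] [NormedAddCommGroup F] [NormedSpace ℝ F]
  (μ : Measure E) [IsAddHaarMeasure μ]

theorem tangentConeAt_eq_univ_of_density_one {s : Set E} {x : E}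
    (h : Tendsto (fun r => μ (s ∩ closedBall x r) / μ (closedBall x r)) (𝓝[>] 0) (𝓝 1)) :
    tangentConeAt ℝ s x = univ := by
  refine eq_univ_of_forall fun z => ?_
  have hfst : Tendsto Prod.fst (𝓝[>] (0 : ℝ) ×ˢ 𝓝 z) (𝓝 0) :=
    tendsto_fst.mono_right nhdsWithin_le_nhds
  refine mem_tangentConeAt_of_frequently (𝓝[>] (0 : ℝ) ×ˢ 𝓝 z) (fun q => q.1⁻¹)
    (fun q => q.1 • q.2) (by simpa using hfst.smul tendsto_snd) (fun hnot => ?_) ?_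
  · obtain ⟨R, hR, Z, hZ, hRZ⟩ := eventually_prod_iff.1 hnot
    obtain ⟨ε, hε, hεZ⟩ := nhds_basis_closedBall.eventually_iff.1 hZ
    obtain ⟨r, ⟨y, hys, hy⟩, hr⟩ := ((eventually_nonempty_inter_smul_of_density_one μ s x h
      (closedBall z ε) measurableSet_closedBall (measure_closedBall_pos μ z hε).ne').and hR).exists
    obtain ⟨_, rfl, _, ⟨a, ha, rfl⟩, rfl⟩ := hy
    exact hRZ hr (hεZ ha) hys
  · refine tendsto_snd.congr' ?_
    filter_upwards [tendsto_fst.eventually self_mem_nhdsWithin] with q hq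
    exact (inv_smul_smul₀ (ne_of_gt hq) q.2).symm

theorem ae_restrict_tangentConeAt_eq_univ (s : Set E) :
    ∀ᵐ x ∂μ.restrict s, tangentConeAt ℝ s x = univ := by
  filter_upwards [Besicovitch.ae_tendsto_measure_inter_div μ s] with x hx
  exact tangentConeAt_eq_univ_of_density_one μ hx

theorem measure_zeros_inter_hasFDerivWithinAt_ne_zero {g : E → F} {g' : E → E →L[ℝ] F} {s : Set E}
    (hg : ∀ x ∈ s, HasFDerivWithinAt g (g' x) s x) :
    μ {x ∈ s | g x = 0 ∧ g' x ≠ 0} = 0 := by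
  set Z := {x ∈ s | g x = 0}
  refine measure_mono_null ?_ (nonpos_iff_eq_zero.1
    ((le_restrict_apply Z _).trans (ae_restrict_tangentConeAt_eq_univ μ Z).le))
  rintro x ⟨hxs, hx0, hx⟩
  refine ⟨fun hcone : tangentConeAt ℝ Z x = univ => hx ?_, hxs, hx0⟩
  have hunique : UniqueDiffWithinAt ℝ Z x := by
    simp [uniqueDiffWithinAt_iff, hcone, subset_closure (show x ∈ Z from ⟨hxs, hx0⟩)]
  have hzero : HasFDerivWithinAt g (0 : E →L[ℝ] F) Z x :=
    (hasFDerivWithinAt_const 0 x Z).congr (fun y hy => hy.2) hx0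
  exact hunique.eq ((hg x hxs).mono (sep_subset _ _)) hzero

end DensityPoints

section CriticalSet

variable {E F : Type*} [NormedAddCommGroup E] [NormedSpace ℝ E] [NormedAddCommGroup F]
  [NormedSpace ℝ F]

/-- The set of points of `s` at which `f` has derivative zero within `s`, that is, the critical
points of `f` on `s` in the sense of one-sided derivatives. Differentiability at these points is
part of the definition. -/
def criticalSetWithin (f : E → F) (s : Set E) : Set E :=
  {x | x ∈ s ∧ HasFDerivWithinAt f (0 : E →L[ℝ] F) s x}

variable {f : E → F} {s : Set E}

theorem criticalSetWithin_subset : criticalSetWithin f s ⊆ s := fun _ hx => hx.1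

theorem criticalSetWithin_inter_subset (f : E → F) (s t : Set E) :
    criticalSetWithin f s ∩ t ⊆ criticalSetWithin f (s ∩ t) :=
  fun _ hx => ⟨⟨hx.1.1, hx.2⟩, hx.1.2.mono inter_subset_left⟩

theorem criticalSetWithin_eq_inter_preimage {f' : E → E →L[ℝ] F} (hs : UniqueDiffOn ℝ s)
    (hf : ∀ x ∈ s, HasFDerivWithinAt f (f' x) s x) :
    criticalSetWithin f s = s ∩ f' ⁻¹' {0} := by
  ext x
  exact and_congr_right fun hx => ⟨(hs x hx).eq (hf x hx), fun h0 => h0 ▸ hf x hx⟩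

theorem isCompact_criticalSetWithin (hsc : IsCompact s) (hs : UniqueDiffOn ℝ s)
    (hf : ContDiffOn ℝ 1 f s) : IsCompact (criticalSetWithin f s) := by
  rw [criticalSetWithin_eq_inter_preimage hs
    fun x hx => (hf.differentiableOn one_ne_zero x hx).hasFDerivWithinAt]
  exact hsc.of_isClosed_subset
    ((hf.continuousOn_fderivWithin hs le_rfl).preimage_isClosed_of_isClosed hsc.isClosed
      isClosed_singleton) inter_subset_left

theorem holderOnWith_two_criticalSetWithin (hs : Convex ℝ s) (hsu : UniqueDiffOn ℝ s)
    {f' : E → E →L[ℝ] F} (hf : ∀ x ∈ s, HasFDerivWithinAt f (f' x) s x) {C : ℝ≥0}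
    (hf' : LipschitzOnWith C f' s) : HolderOnWith C 2 f (criticalSetWithin f s) := by
  intro y hy x hx
  have hx0 : f' x = 0 := (hsu x hx.1).eq (hf x hx.1) hx.2
  have hbound : ∀ z ∈ s ∩ closedBall x (dist y x), ‖f' z‖ ≤ C * dist y x := by
    rintro z ⟨hzs, hzx⟩
    calc ‖f' z‖ = dist (f' z) (f' x) := by rw [hx0, dist_zero_right]
      _ ≤ C * dist z x := hf'.dist_le_mul z hzs x hx.1
      _ ≤ C * dist y x := by gcongr; exact hzx
  have hdist : dist (f y) (f x) ≤ C * dist y x ^ 2 := by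
    rw [dist_eq_norm, sq, ← mul_assoc, dist_eq_norm y x]
    rw [dist_eq_norm y x] at hbound
    exact (hs.inter (convex_closedBall x _)).norm_image_sub_le_of_norm_hasFDerivWithin_le
      (fun z hz => (hf z hz.1).mono inter_subset_left) hbound
      ⟨hx.1, mem_closedBall_self (norm_nonneg _)⟩ ⟨hy.1, (dist_eq_norm y x).le⟩
  calc edist (f y) (f x) ≤ ENNReal.ofReal (C * dist y x ^ 2) := by
        rw [edist_dist]
        exact ENNReal.ofReal_le_ofReal hdist
    _ = C * edist y x ^ ((2 : ℝ≥0) : ℝ) := by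
        rw [ENNReal.ofReal_mul C.coe_nonneg, ENNReal.ofReal_coe_nnreal,
          ENNReal.ofReal_pow dist_nonneg, edist_dist, NNReal.coe_ofNat, ENNReal.rpow_ofNat]

theorem exists_nhdsWithin_holderOnWith_two_criticalSetWithin (hs : Convex ℝ s)
    (hsu : UniqueDiffOn ℝ s) {f' : E → E →L[ℝ] F} {f'' : E → E →L[ℝ] E →L[ℝ] F}
    (hf : ∀ x ∈ s, HasFDerivWithinAt f (f' x) s x)
    (hf' : ∀ x ∈ s, HasFDerivWithinAt f' (f'' x) s x) {x : E}
    (hf'' : ContinuousWithinAt f'' s x) {C : ℝ≥0} (hC : ‖f'' x‖₊ < C) :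
    ∃ t ∈ 𝓝[criticalSetWithin f s] x, HolderOnWith C 2 f t := by
  obtain ⟨u, hu, hLip⟩ := hs.exists_nhdsWithin_lipschitzOnWith_of_hasFDerivWithinAt_of_nnnorm_lt
    (eventually_mem_nhdsWithin.mono hf') hf'' C hC
  obtain ⟨ε, hε, hεu⟩ := mem_nhdsWithin_iff.1 hu
  refine ⟨criticalSetWithin f s ∩ ball x ε, inter_mem_nhdsWithin _ (ball_mem_nhds x hε), ?_⟩
  exact (holderOnWith_two_criticalSetWithin (hs.inter (convex_ball x ε)) (hsu.inter isOpen_ball)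
    (fun y hy => (hf y hy.1).mono inter_subset_left)
    (hLip.mono (inter_comm _ _ ▸ hεu))).mono (criticalSetWithin_inter_subset f s _)

variable [FiniteDimensional ℝ E] [MeasurableSpace F] [BorelSpace F]

theorem hausdorffMeasure_image_criticalSetWithin_second_fderiv_ne_zero (hs : Convex ℝ s)
    (hsu : UniqueDiffOn ℝ s) {f' : E → E →L[ℝ] F} {f'' : E → E →L[ℝ] E →L[ℝ] F}
    (hf : ∀ x ∈ s, HasFDerivWithinAt f (f' x) s x)
    (hf' : ∀ x ∈ s, HasFDerivWithinAt f' (f'' x) s x) (hf'' : ContinuousOn f'' s) :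
    μH[finrank ℝ E / 2] (f '' {x ∈ criticalSetWithin f s | f'' x ≠ 0}) = 0 := by
  borelize E
  refine hausdorffMeasure_image_null_of_locally_holderOnWith two_pos (by positivity) ?_
    fun x hx => ?_
  · rw [NNReal.coe_ofNat, mul_div_cancel₀ _ two_ne_zero]
    refine measure_mono_null ?_ (measure_zeros_inter_hasFDerivWithinAt_ne_zero _ hf')
    rintro x ⟨hx, hne⟩
    exact ⟨hx.1, (hsu x hx.1).eq (hf x hx.1) hx.2, hne⟩
  · obtain ⟨t, ht, hC⟩ := exists_nhdsWithin_holderOnWith_two_criticalSetWithin hs hsu hf hf'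
      (hf'' x hx.1.1) (lt_add_one ‖f'' x‖₊)
    exact ⟨_, t, nhdsWithin_mono x (sep_subset _ _) ht, hC⟩

theorem hausdorffMeasure_image_criticalSetWithin_second_fderiv_eq_zero [Nontrivial E]
    (hs : Convex ℝ s) (hsu : UniqueDiffOn ℝ s) {f' : E → E →L[ℝ] F} {f'' : E → E →L[ℝ] E →L[ℝ] F}
    (hf : ∀ x ∈ s, HasFDerivWithinAt f (f' x) s x)
    (hf' : ∀ x ∈ s, HasFDerivWithinAt f' (f'' x) s x) (hf'' : ContinuousOn f'' s) :
    μH[finrank ℝ E / 2] (f '' {x ∈ criticalSetWithin f s | f'' x = 0}) = 0 := by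
  borelize E
  have : IsLocallyFiniteMeasure (μH[((2 : ℝ≥0) : ℝ) * (finrank ℝ E / 2)] : Measure E) := by
    rw [NNReal.coe_ofNat, mul_div_cancel₀ _ two_ne_zero]
    infer_instance
  refine hausdorffMeasure_image_null_of_locally_holderOnWith_small two_pos
    (half_pos (Nat.cast_pos.2 finrank_pos)) fun x hx ε hε => ?_
  have hlt : ‖f'' x‖₊ < ε := by
    rw [hx.2]
    exact (nnnorm_zero (E := E →L[ℝ] E →L[ℝ] F)).trans_lt hε
  obtain ⟨t, ht, hC⟩ := exists_nhdsWithin_holderOnWith_two_criticalSetWithin hs hsu hf hf'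
    (hf'' x hx.1.1) hlt
  exact ⟨t, nhdsWithin_mono x (sep_subset _ _) ht, hC⟩

theorem hausdorffMeasure_image_criticalSetWithin_eq_zero [Nontrivial E] (hs : Convex ℝ s)
    (hsu : UniqueDiffOn ℝ s) (hf : ContDiffOn ℝ 2 f s) :
    μH[finrank ℝ E / 2] (f '' criticalSetWithin f s) = 0 := by
  let f' := fderivWithin ℝ f s
  let f'' := fderivWithin ℝ f' s
  have hf'c : ContDiffOn ℝ 1 f' s := hf.fderivWithin hsu one_add_one_eq_two.le
  have hf' : ∀ x ∈ s, HasFDerivWithinAt f (f' x) s x := fun x hx =>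
    (hf.differentiableOn two_ne_zero x hx).hasFDerivWithinAt
  have hf'' : ∀ x ∈ s, HasFDerivWithinAt f' (f'' x) s x := fun x hx =>
    (hf'c.differentiableOn one_ne_zero x hx).hasFDerivWithinAt
  have hf''c : ContinuousOn f'' s := hf'c.continuousOn_fderivWithin hsu le_rfl
  have hsplit : criticalSetWithin f s ⊆
      {x ∈ criticalSetWithin f s | f'' x ≠ 0} ∪ {x ∈ criticalSetWithin f s | f'' x = 0} :=
    fun x hx => (ne_or_eq (f'' x) 0).imp (And.intro hx) (And.intro hx)
  exact measure_mono_null ((image_mono hsplit).trans_eq (image_union _ _ _)) (measure_union_null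
    (hausdorffMeasure_image_criticalSetWithin_second_fderiv_ne_zero hs hsu hf' hf'' hf''c)
    (hausdorffMeasure_image_criticalSetWithin_second_fderiv_eq_zero hs hsu hf' hf'' hf''c))

theorem hausdorffMeasure_image_criticalSetWithin_contDiffWithinAt_eq_zero [Nontrivial E]
    (hs : Convex ℝ s) (hsu : UniqueDiffOn ℝ s) (f : E → F) :
    μH[finrank ℝ E / 2] (f '' {x ∈ criticalSetWithin f s | ContDiffWithinAt ℝ 2 f s x}) = 0 := by
  refine measure_image_null_of_locally_null fun x ⟨hx, hfx⟩ => ?_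
  obtain ⟨u, huo, hxu, hfu⟩ := hfx.contDiffOn' le_rfl (by simp)
  rw [insert_eq_of_mem hx.1] at hfu
  obtain ⟨ε, hε, hεu⟩ := Metric.isOpen_iff.1 huo x hxu
  refine ⟨_, inter_mem_nhdsWithin _ (ball_mem_nhds x hε), measure_mono_null (image_mono ?_)
    (hausdorffMeasure_image_criticalSetWithin_eq_zero (hs.inter (convex_ball x ε))
      (hsu.inter isOpen_ball) (hfu.mono (inter_subset_inter_right s hεu)))⟩
  exact (inter_subset_inter_left _ (sep_subset _ _)).trans (criticalSetWithin_inter_subset f s _)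

end CriticalSet

section SumAbsRpow

variable {E : Type*} [NormedAddCommGroup E] [NormedSpace ℝ E] {s : Set E} {x : E} {p : ℝ}

theorem contDiffWithinAt_abs_rpow_of_ne_zero {u : E → ℝ} {n : ℕ∞}
    (hu : ContDiffWithinAt ℝ n u s x) (hx : u x ≠ 0) :
    ContDiffWithinAt ℝ n (fun y => |u y| ^ p) s x :=
  ((contDiffAt_abs hx).rpow_const_of_ne (abs_ne_zero.2 hx)).comp_contDiffWithinAt x hu

theorem hasFDerivWithinAt_abs_rpow_of_eq_zero (hp : 1 < p) {u : E → ℝ}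
    (hu : DifferentiableWithinAt ℝ u s x) (hx : u x = 0) :
    HasFDerivWithinAt (fun y => |u y| ^ p) (0 : E →L[ℝ] ℝ) s x := by
  have hcomp := (hasDerivAt_abs_rpow (u x) hp).comp_hasFDerivWithinAt x hu.hasFDerivWithinAt
  rwa [hx, mul_zero, zero_smul] at hcomp

variable {ι : Type*} [Fintype ι] {u : ι → E → ℝ}

theorem hasFDerivWithinAt_partial_sum {F : Type*} [NormedAddCommGroup F] [NormedSpace ℝ F]
    {f : ι → E → F} {f' : E →L[ℝ] F} {T : Finset ι}
    (hf : HasFDerivWithinAt (fun y => ∑ i, f i y) f' s x)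
    (h0 : ∀ i ∉ T, HasFDerivWithinAt (f i) (0 : E →L[ℝ] F) s x) :
    HasFDerivWithinAt (fun y => ∑ i ∈ T, f i y) f' s x := by
  classical
  have hrest : HasFDerivWithinAt (fun y => ∑ i ∈ Tᶜ, f i y) (∑ _ ∈ Tᶜ, (0 : E →L[ℝ] F)) s x :=
    HasFDerivWithinAt.fun_sum fun _ hi => h0 _ (Finset.mem_compl.1 hi)
  have hsub := hf.fun_sub hrest
  rw [Finset.sum_const_zero, sub_zero] at hsub
  simpa only [← Finset.sum_add_sum_compl T, add_sub_cancel_right] using hsub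

theorem mem_criticalSetWithin_partial_sum_abs_rpow (hp : 1 < p)
    (hu : ∀ i, DifferentiableWithinAt ℝ (u i) s x) {T : Finset ι} (hT : ∀ i ∉ T, u i x = 0)
    (hx : x ∈ criticalSetWithin (fun y => ∑ i, |u i y| ^ p) s) :
    x ∈ criticalSetWithin (fun y => ∑ i ∈ T, |u i y| ^ p) s :=
  ⟨hx.1, hasFDerivWithinAt_partial_sum hx.2 fun i hi =>
    hasFDerivWithinAt_abs_rpow_of_eq_zero hp (hu i) (hT i hi)⟩

theorem hausdorffMeasure_image_criticalSetWithin_sum_abs_rpow [FiniteDimensional ℝ E] [Nontrivial E]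
    (hs : Convex ℝ s) (hsu : UniqueDiffOn ℝ s) (hu : ∀ i, ContDiffOn ℝ 2 (u i) s) (hp : 1 < p) :
    μH[finrank ℝ E / 2] ((fun x => ∑ i, |u i x| ^ p) ''
      criticalSetWithin (fun x => ∑ i, |u i x| ^ p) s) = 0 := by
  classical
  let f (T : Finset ι) (x : E) : ℝ := ∑ i ∈ T, |u i x| ^ p
  suffices hcover : f Finset.univ '' criticalSetWithin (f Finset.univ) s ⊆
      ⋃ T, f T '' {x ∈ criticalSetWithin (f T) s | ContDiffWithinAt ℝ 2 (f T) s x} from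
    measure_mono_null hcover (measure_iUnion_null fun T =>
      hausdorffMeasure_image_criticalSetWithin_contDiffWithinAt_eq_zero hs hsu (f T))
  rintro _ ⟨x, hx, rfl⟩
  let T : Finset ι := {i | u i x ≠ 0}
  have hT : ∀ i ∉ T, u i x = 0 := by simp [T]
  have hvalue : f T x = f Finset.univ x := by
    refine Finset.sum_subset (Finset.subset_univ T) fun i _ hi => ?_
    rw [hT i hi, abs_zero, Real.zero_rpow (zero_lt_one.trans hp).ne']
  have hsmooth : ContDiffWithinAt ℝ 2 (f T) s x := ContDiffWithinAt.sum fun _ hi =>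
    contDiffWithinAt_abs_rpow_of_ne_zero (hu _ x hx.1) (Finset.mem_filter.1 hi).2
  have hcrit : x ∈ criticalSetWithin (f T) s := mem_criticalSetWithin_partial_sum_abs_rpow hp
    (fun i => (hu i).differentiableOn two_ne_zero x hx.1) hT hx
  exact mem_iUnion.2 ⟨T, x, ⟨hcrit, hsmooth⟩, hvalue⟩

end SumAbsRpow

section Curves

theorem isCompact_unitSquare : IsCompact unitSquare := isCompact_Icc.prod isCompact_Icc

theorem convex_unitSquare : Convex ℝ unitSquare := (convex_Icc 0 1).prod (convex_Icc 0 1)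

theorem uniqueDiffOn_unitSquare : UniqueDiffOn ℝ unitSquare :=
  (uniqueDiffOn_Icc one_pos).prod (uniqueDiffOn_Icc one_pos)

variable {d : ℕ} {γ₁ γ₂ : ℝ → Fin d → ℝ} {p : ℝ}

theorem contDiffOn_coordinate_sub {n : WithTop ℕ∞} (hγ₁ : ContDiffOn ℝ n γ₁ (Icc 0 1))
    (hγ₂ : ContDiffOn ℝ n γ₂ (Icc 0 1)) (i : Fin d) :
    ContDiffOn ℝ n (fun t : ℝ × ℝ => γ₁ t.1 i - γ₂ t.2 i) unitSquare :=
  ((contDiffOn_pi.1 hγ₁ i).comp contDiffOn_fst fun _ ht => ht.1).sub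
    ((contDiffOn_pi.1 hγ₂ i).comp contDiffOn_snd fun _ ht => ht.2)

theorem contDiffOn_distPow (hγ₁ : ContDiffOn ℝ 1 γ₁ (Icc 0 1))
    (hγ₂ : ContDiffOn ℝ 1 γ₂ (Icc 0 1)) (hp : 1 < p) :
    ContDiffOn ℝ 1 (distPow p γ₁ γ₂) unitSquare :=
  ContDiffOn.sum fun i _ =>
    (contDiff_norm_rpow (E := ℝ) hp).comp_contDiffOn (contDiffOn_coordinate_sub hγ₁ hγ₂ i)

theorem isOpen_regularValues (hγ₁ : ContDiffOn ℝ 1 γ₁ (Icc 0 1))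
    (hγ₂ : ContDiffOn ℝ 1 γ₂ (Icc 0 1)) (hp : 1 < p) : IsOpen (regularValues p γ₁ γ₂) := by
  have hf := contDiffOn_distPow hγ₁ hγ₂ hp
  have hcompact : IsCompact (criticalPoints p γ₁ γ₂) :=
    isCompact_criticalSetWithin isCompact_unitSquare uniqueDiffOn_unitSquare hf
  exact (hcompact.image_of_continuousOn
    (hf.continuousOn.mono criticalSetWithin_subset)).isClosed.isOpen_compl

theorem volume_image_criticalPoints_eq_zero (hγ₁ : ContDiffOn ℝ 2 γ₁ (Icc 0 1))
    (hγ₂ : ContDiffOn ℝ 2 γ₂ (Icc 0 1)) (hp : 1 < p) :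
    volume (distPow p γ₁ γ₂ '' criticalPoints p γ₁ γ₂) = 0 := by
  have hnull := hausdorffMeasure_image_criticalSetWithin_sum_abs_rpow convex_unitSquare
    uniqueDiffOn_unitSquare (contDiffOn_coordinate_sub hγ₁ hγ₂) hp
  have hdim : (finrank ℝ (ℝ × ℝ) : ℝ) / 2 = 1 := by simp [finrank_prod, one_add_one_eq_two]
  rwa [hdim, hausdorffMeasure_real] at hnull

theorem dense_regularValues (hγ₁ : ContDiffOn ℝ 2 γ₁ (Icc 0 1))
    (hγ₂ : ContDiffOn ℝ 2 γ₂ (Icc 0 1)) (hp : 1 < p) : Dense (regularValues p γ₁ γ₂) :=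
  dense_of_ae (measure_eq_zero_iff_ae_notMem.1 (volume_image_criticalPoints_eq_zero hγ₁ hγ₂ hp))

end Curves

theorem proposition3p1_general {d : ℕ} (γ₁ γ₂ : ℝ → Fin d → ℝ)
    (hγ₁ : ContDiffOn ℝ 2 γ₁ (Icc 0 1)) (hγ₂ : ContDiffOn ℝ 2 γ₂ (Icc 0 1)) (p : ℝ) (hp : 1 < p) :
    IsOpen (regularValues p γ₁ γ₂) ∧ Dense (regularValues p γ₁ γ₂) :=
  ⟨isOpen_regularValues (hγ₁.of_le one_le_two) (hγ₂.of_le one_le_two) hp,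
    dense_regularValues hγ₁ hγ₂ hp⟩

theorem proposition3p1 {d : ℕ} (γ₁ γ₂ : ℝ → Fin d → ℝ)
    (hγ₁ : ContDiffOn ℝ 2 γ₁ (Icc 0 1)) (hγ₂ : ContDiffOn ℝ 2 γ₂ (Icc 0 1)) :
    (∀ p : ℝ, 1 < p → IsOpen (regularValues p γ₁ γ₂)) ∧
    (∀ p : ℝ, 2 ≤ p → Dense (regularValues p γ₁ γ₂)) ∧
    (∀ p : ℝ, 1 < p → p < 2 →
      ∃ U : Set ℝ, IsOpen U ∧ Dense U ∧
        ∀ t ∈ criticalPoints p γ₁ γ₂, distPow p γ₁ γ₂ t ∈ U →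
          ∃ i : Fin d, γ₁ t.1 i = γ₂ t.2 i) ∧
    (volume (commonCriticalParameters γ₁ γ₂) = 0 →
      ∀ p : ℝ, 1 < p → Dense (regularValues p γ₁ γ₂)) := by
  have hgen := proposition3p1_general γ₁ γ₂ hγ₁ hγ₂
  exact ⟨fun p hp => (hgen p hp).1, fun p hp => (hgen p (one_lt_two.trans_le hp)).2,
    fun p hp _ => ⟨_, (hgen p hp).1, (hgen p hp).2,
      fun t ht hU => absurd (mem_image_of_mem _ ht) hU⟩,
    fun _ p hp => (hgen p hp).2⟩
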